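/- For a boolean matrix $A$, a rectangle is a nonempty set of rows together with a nonempty set of columns, identified with the matrix having ones inside it and zeros outside; an $a\times b$ rectangle has complexity $a+b$ and spectral weight $\sqrt{ab}$. A SUM-covering of $A$ is a finite family of rectangles whose sum, with integer addition, is $A$; its complexity and its spectral weight $\sigma$ are the sums of those of its rectangles, and $\mathrm{SUM}_2(A)$ is the least complexity of a SUM-covering of $A$. For $N=2^n$, the Kneser–Sierpinski matrix $D_N$ is the $N\times N$ matrix with rows and columns labeled by the subsets of $[n]$ and $D_N[u,v]=1$ iff $u\cap v=\emptyset$ (and $0$ otherwise). Let $F_{15}$ be the following family of rectangles of width $1$ in $D_{2^{15}}$: for each $v\subseteq[15]$ with $2|v|\le 15$, the part of column $v$ in the rows $u$ with $|u|\ge|v|$ and $u\cap v=\emptyset$; and for each $u\subseteq[15]$ with $2|u|<15$, the part of row $u$ in the columns $v$ with $|v|>|u|$ and $u\cap v=\emptyset$. **Corollary.** $F_{15}$ is a SUM-covering of $D_{2^{15}}$. There is a constant $C>0$ such that for all $n\ge 0$ and $N=2^n$, $$\mathrm{SUM}_2(D_N)\le C\,N^{\log_{2^{15}}\sigma(F_{15})},$$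 and, as $N=2^n\to\infty$, $N^{\log_{2^{15}}\sigma(F_{15})}=o(N^{1.251})$. -/

import Mathlib

open Filter Asymptotics

namespace KneserSierpinski

/-- A rectangle in an `m × n` matrix, given by its set of rows and its set of columns. -/
structure Rect (m n : Type*) where
  rows : Finset m
  cols : Finset n

namespace Rect

variable {m n : Type*}

/-- A genuine rectangle has at least one row and at least one column. -/
def Nonempty (R : Rect m n) : Prop := R.rows.Nonempty ∧ R.cols.Nonempty

/-- The rank-one matrix of a rectangle: all ones inside it and all zeros outside. -/
def toMatrix [DecidableEq m] [DecidableEq n] (R : Rect m n) : Matrix m n ℕ :=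
  Matrix.of fun i j => if i ∈ R.rows ∧ j ∈ R.cols then 1 else 0

/-- The complexity `w(R) = a + b` of an `a × b` rectangle. -/
def complexity (R : Rect m n) : ℕ := R.rows.card + R.cols.card

/-- The spectral weight `σ(R) = √(a b)` of an `a × b` rectangle. -/
noncomputable def spectralWeight (R : Rect m n) : ℝ :=
  Real.sqrt ((R.rows.card : ℝ) * (R.cols.card : ℝ))

end Rect

/-- `F` is a `SUM`-covering of `A`: `A` is the sum of the rectangles in `F`, the addition of
entries being that of integers. For such a covering a multiset is the same as a set when `A` is
boolean, since a repeated rectangle would produce an entry that is at least `2`. -/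
def IsSumCovering {m n : Type*} [DecidableEq m] [DecidableEq n]
    (F : Multiset (Rect m n)) (A : Matrix m n ℕ) : Prop :=
  (∀ R ∈ F, R.Nonempty) ∧ A = (F.map Rect.toMatrix).sum

/-- The complexity `w(F)` of a family of rectangles. -/
def coveringComplexity {m n : Type*} (F : Multiset (Rect m n)) : ℕ :=
  (F.map Rect.complexity).sum

/-- The spectral weight `σ(F)` of a family of rectangles. -/
noncomputable def coveringSpectralWeight {m n : Type*} (F : Multiset (Rect m n)) : ℝ :=
  (F.map Rect.spectralWeight).sum

/-- `SUM₂(A)`, the least complexity of a `SUM`-covering of the boolean matrix `A`. -/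
noncomputable def sumComplexity {m n : Type*} [DecidableEq m] [DecidableEq n]
    (A : Matrix m n ℕ) : ℕ :=
  sInf {w | ∃ F : Multiset (Rect m n), IsSumCovering F A ∧ coveringComplexity F = w}

/-- The `N × N` Kneser–Sierpinski (disjointness) matrix `D_N` for `N = 2 ^ n`: rows and columns
are labelled by the subsets of an `n`-element set. -/
def disjointnessMatrix (n : ℕ) : Matrix (Finset (Fin n)) (Finset (Fin n)) ℕ :=
  Matrix.of fun u v => if Disjoint u v then 1 else 0

/-- The part of the column `v` that remains after the extraction of all columns and all rows with
labels smaller than `v`: the rows `u` disjoint from `v` with `|v| ≤ |u|`. -/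
def columnRect (t : ℕ) (v : Finset (Fin t)) : Rect (Finset (Fin t)) (Finset (Fin t)) where
  rows := Finset.univ.filter fun u => v.card ≤ u.card ∧ Disjoint u v
  cols := {v}

/-- The part of the row `u` that remains after the extraction of all columns with labels of size
at most `|u|` and all rows with labels smaller than `u`: the columns `v` disjoint from `u` with
`|u| < |v|`. -/
def rowRect (t : ℕ) (u : Finset (Fin t)) : Rect (Finset (Fin t)) (Finset (Fin t)) where
  rows := {u}
  cols := Finset.univ.filter fun v => u.card < v.card ∧ Disjoint u v

/-- The width-one "gradient" covering `F_t` of `D_{2 ^ t}`: all columns and rows are extracted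
in the order of the sizes `k = 0, 1, 2, …` of their labels, the columns of a given size before the
rows of that size. A column of size `k` contributes a nonempty rectangle iff `2 k ≤ t`, a row of
size `k` iff `2 k < t`. -/
def gradientCovering (t : ℕ) : Multiset (Rect (Finset (Fin t)) (Finset (Fin t))) :=
  ((Finset.univ.filter fun v : Finset (Fin t) => 2 * v.card ≤ t).val.map (columnRect t)) +
    ((Finset.univ.filter fun u : Finset (Fin t) => 2 * u.card < t).val.map (rowRect t))

end KneserSierpinski

/-!
Let `σ` be the spectral weight of the gradient covering `F` of `D_{2 ^ 15}`. Since
`D_{2 ^ (s + t)} = D_{2 ^ s} ⊗ D_{2 ^ t}`, tensor powers of `F` cover `D_{2 ^ (15 * m)}` with spectral weight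
`σ ^ m`. The complexity `a + b` of an `a × b` rectangle exceeds `√(a b)` by an arbitrary factor
when the rectangle is unbalanced, so the covering is built adaptively (`HasCover.bind`): the
covering of the next factor `D_{2 ^ 15}` depends on the shape `a × b` of the rectangle that it
multiplies. By transposition one may assume `b ≤ a`.

* If `a / b` is moderate, the transpose of `F` is used. It has spectral weight exactly `σ`, and
  its rectangles have on average more columns than rows, which pushes the product back to balance.
  In quantitative terms, the sum of `r ^ 0.54 * c ^ 0.46` over its `r × c` rectangles is less than
  `σ` (`moment_gradientCovering_fifteen_le`), so the weight carried by rectangles with large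
  `a / b` decays geometrically.
* If `a / b` is exponentially large in the number `k` of remaining factors, `D_{2 ^ 15}` is
  covered by its rows. This is wasteful for the spectral weight, but it multiplies the total
  number of rows by `2 ^ 15` only, which is far less than `σ`, and its moment with exponent `0.54`
  is less than `σ`, too.

Both cases are controlled by one function, `potential`, which combines `√(a b)`, the two weighted
geometric means with exponents `0.54` and `0.46`, and `a + b`. Its value after one more factor
bounds the sum of its values over the rectangles produced (`sum_map_potential_le_of_balanced`,
`sum_map_potential_le_of_unbalanced`). The coefficient of `√(a b)` grows by the factor `σ` in a
step, up to summable relative errors, so no subexponential factor is lost and the complexity is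
`O(σ ^ m)`.

The numerical input is that `σ = 442411.8…` lies between `442400` and `445000 < 2 ^ (15 * 1.251)`.
-/

namespace KneserSierpinski

/-! ### Coverings and their products -/

section Covering

variable {m n : Type*} [DecidableEq m] [DecidableEq n]

theorem isSumCovering_iff {F : Multiset (Rect m n)} {A : Matrix m n ℕ} :
    IsSumCovering F A ↔ (∀ R ∈ F, R.Nonempty) ∧
      ∀ i j, A i j = (F.map fun R => if i ∈ R.rows ∧ j ∈ R.cols then 1 else 0).sum := by
  have key : ∀ i j, (F.map Rect.toMatrix).sum i j =
      (F.map fun R => if i ∈ R.rows ∧ j ∈ R.cols then 1 else 0).sum := by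
    intro i j
    induction F using Multiset.induction_on with
    | empty => simp
    | cons R F ih => simp [ih, Rect.toMatrix, Matrix.add_apply]
  unfold IsSumCovering
  refine and_congr_right fun _ => ⟨fun h i j => ?_, fun h => ?_⟩
  · rw [← key, ← h]
  · ext i j
    rw [key, h]

/-- The transposed rectangle. -/
def Rect.transpose (R : Rect m n) : Rect n m := ⟨R.cols, R.rows⟩

theorem IsSumCovering.transpose {F : Multiset (Rect m n)} {A : Matrix m n ℕ}
    (h : IsSumCovering F A) : IsSumCovering (F.map Rect.transpose) A.transpose := by
  rw [isSumCovering_iff] at h ⊢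
  refine ⟨fun R hR => ?_, fun i j => ?_⟩
  · obtain ⟨S, hS, rfl⟩ := Multiset.mem_map.1 hR
    exact (h.1 S hS).symm
  · rw [Matrix.transpose_apply, h.2, Multiset.map_map]
    exact congrArg _ (Multiset.map_congr rfl fun R _ => if_congr and_comm rfl rfl)

end Covering

theorem disjointnessMatrix_transpose (n : ℕ) :
    (disjointnessMatrix n).transpose = disjointnessMatrix n := by
  ext u v
  simp [disjointnessMatrix, disjoint_comm]

theorem IsSumCovering.transpose_disjointnessMatrix {n : ℕ}
    {F : Multiset (Rect (Finset (Fin n)) (Finset (Fin n)))}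
    (h : IsSumCovering F (disjointnessMatrix n)) :
    IsSumCovering (F.map Rect.transpose) (disjointnessMatrix n) := by
  simpa only [disjointnessMatrix_transpose] using h.transpose

/-- The gradient covering is a covering: the entry at disjoint `u`, `v` belongs to the column `v`
if `|v| ≤ |u|` and to the row `u` otherwise, and `|u| + |v| ≤ t` makes the size restriction on the
label of that line automatic. -/
theorem isSumCovering_gradientCovering (t : ℕ) :
    IsSumCovering (gradientCovering t) (disjointnessMatrix t) := by
  rw [isSumCovering_iff]
  refine ⟨fun R hR => ?_, fun u v => ?_⟩
  · simp only [gradientCovering, Multiset.mem_add, Multiset.mem_map, Finset.mem_val,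
      Finset.mem_filter, Finset.mem_univ, true_and] at hR
    rcases hR with ⟨v, hv, rfl⟩ | ⟨u, hu, rfl⟩
    · refine ⟨⟨vᶜ, ?_⟩, ⟨v, by simp [columnRect]⟩⟩
      simp only [columnRect, Finset.mem_filter, Finset.mem_univ, true_and, Finset.card_compl,
        Fintype.card_fin]
      exact ⟨by omega, disjoint_compl_left⟩
    · refine ⟨⟨u, by simp [rowRect]⟩, ⟨uᶜ, ?_⟩⟩
      simp only [rowRect, Finset.mem_filter, Finset.mem_univ, true_and, Finset.card_compl,
        Fintype.card_fin]
      exact ⟨by omega, disjoint_compl_right⟩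
  · have h₁ : ∀ x : Finset (Fin t), (u ∈ (columnRect t x).rows ∧ v ∈ (columnRect t x).cols) ↔
        (x = v ∧ v.card ≤ u.card ∧ Disjoint u v) := by
      intro x
      simp only [columnRect, Finset.mem_filter, Finset.mem_univ, true_and, Finset.mem_singleton]
      constructor
      · rintro ⟨h, rfl⟩; exact ⟨rfl, h⟩
      · rintro ⟨rfl, h⟩; exact ⟨h, rfl⟩
    have h₂ : ∀ x : Finset (Fin t), (u ∈ (rowRect t x).rows ∧ v ∈ (rowRect t x).cols) ↔
        (x = u ∧ u.card < v.card ∧ Disjoint u v) := by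
      intro x
      simp only [rowRect, Finset.mem_filter, Finset.mem_univ, true_and, Finset.mem_singleton]
      constructor
      · rintro ⟨rfl, h⟩; exact ⟨rfl, h⟩
      · rintro ⟨rfl, h⟩; exact ⟨rfl, h⟩
    simp only [gradientCovering, Multiset.map_add, Multiset.map_map, Multiset.sum_add,
      Function.comp_def, h₁, h₂, Finset.sum_map_val]
    simp only [ite_and, Finset.sum_ite_eq', Finset.mem_filter, Finset.mem_univ, true_and]
    have hle : Disjoint u v → u.card + v.card ≤ t := fun h => by
      simpa [Finset.card_union_of_disjoint h] using Finset.card_le_univ (u ∪ v)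
    simp only [disjointnessMatrix, Matrix.of_apply]
    by_cases h : Disjoint u v
    · have := hle h
      simp only [h, if_true]
      split_ifs <;> omega
    · simp [h]

/-- The part of row `u` of `D_{2 ^ t}` that consists of ones. -/
def fullRowRect (t : ℕ) (u : Finset (Fin t)) : Rect (Finset (Fin t)) (Finset (Fin t)) where
  rows := {u}
  cols := uᶜ.powerset

/-- The covering of `D_{2 ^ t}` by its rows. -/
def rowCovering (t : ℕ) : Multiset (Rect (Finset (Fin t)) (Finset (Fin t))) :=
  Finset.univ.val.map (fullRowRect t)

theorem isSumCovering_rowCovering (t : ℕ) :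
    IsSumCovering (rowCovering t) (disjointnessMatrix t) := by
  rw [isSumCovering_iff]
  refine ⟨fun R hR => ?_, fun u v => ?_⟩
  · obtain ⟨u, -, rfl⟩ := Multiset.mem_map.1 hR
    exact ⟨⟨u, by simp [fullRowRect]⟩, ⟨∅, by simp [fullRowRect]⟩⟩
  · simp only [rowCovering, Multiset.map_map, Function.comp_def, fullRowRect,
      Finset.mem_singleton, Finset.mem_powerset, ite_and, Finset.sum_map_val, Finset.sum_ite_eq,
      Finset.mem_univ, if_true, disjointnessMatrix, Matrix.of_apply]
    exact if_congr (le_compl_iff_disjoint_left (a := v) (b := u)).symm rfl rfl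

/-- Subsets of `[t + n]` are pairs of a subset of `[t]` and a subset of `[n]`. -/
def subsetProdEquiv (t n : ℕ) :
    Finset (Fin t) × Finset (Fin n) ≃ Finset (Fin (t + n)) :=
  Finset.sumEquiv.symm.toEquiv.trans finSumFinEquiv.finsetCongr

theorem disjoint_subsetProdEquiv {t n : ℕ} (p q : Finset (Fin t) × Finset (Fin n)) :
    Disjoint (subsetProdEquiv t n p) (subsetProdEquiv t n q) ↔
      Disjoint p.1 q.1 ∧ Disjoint p.2 q.2 := by
  simp only [subsetProdEquiv, Equiv.trans_apply, Equiv.finsetCongr_apply, Finset.disjoint_map]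
  simp [Finset.disjoint_left, Sum.forall]

/-- The Kronecker product of a rectangle in `D_{2 ^ t}` and a rectangle in `D_{2 ^ n}`, as a
rectangle in `D_{2 ^ (t + n)}`. -/
def Rect.kronecker {t n : ℕ} (R : Rect (Finset (Fin t)) (Finset (Fin t)))
    (S : Rect (Finset (Fin n)) (Finset (Fin n))) :
    Rect (Finset (Fin (t + n))) (Finset (Fin (t + n))) where
  rows := (R.rows ×ˢ S.rows).map (subsetProdEquiv t n).toEmbedding
  cols := (R.cols ×ˢ S.cols).map (subsetProdEquiv t n).toEmbedding

/-- If every rectangle `R` of a covering of `D_{2 ^ t}` comes with its own covering `G R` of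
`D_{2 ^ n}`, the products `R ⊗ S` with `S` in `G R` cover `D_{2 ^ (t + n)}`. -/
theorem IsSumCovering.bind_kronecker {t n : ℕ}
    {H : Multiset (Rect (Finset (Fin t)) (Finset (Fin t)))}
    {G : Rect (Finset (Fin t)) (Finset (Fin t)) →
      Multiset (Rect (Finset (Fin n)) (Finset (Fin n)))}
    (hH : IsSumCovering H (disjointnessMatrix t))
    (hG : ∀ R ∈ H, IsSumCovering (G R) (disjointnessMatrix n)) :
    IsSumCovering (H.bind fun R => (G R).map R.kronecker) (disjointnessMatrix (t + n)) := by
  rw [isSumCovering_iff] at hH ⊢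
  refine ⟨fun T hT => ?_, fun x y => ?_⟩
  · obtain ⟨R, hR, hT⟩ := Multiset.mem_bind.1 hT
    obtain ⟨S, hS, rfl⟩ := Multiset.mem_map.1 hT
    have h₁ := hH.1 R hR
    have h₂ := (hG R hR).1 S hS
    exact ⟨(h₁.1.product h₂.1).map, (h₁.2.product h₂.2).map⟩
  · obtain ⟨p, rfl⟩ := (subsetProdEquiv t n).surjective x
    obtain ⟨q, rfl⟩ := (subsetProdEquiv t n).surjective y
    have hprod : disjointnessMatrix (t + n) (subsetProdEquiv t n p) (subsetProdEquiv t n q) =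
        disjointnessMatrix t p.1 q.1 * disjointnessMatrix n p.2 q.2 := by
      simp only [disjointnessMatrix, Matrix.of_apply, disjoint_subsetProdEquiv, ite_and]
      split_ifs <;> simp
    rw [hprod, hH.2, ← Multiset.sum_map_mul_right, Multiset.map_bind, Multiset.sum_bind]
    refine congrArg _ (Multiset.map_congr rfl fun R hR => ?_)
    rw [(isSumCovering_iff.1 (hG R hR)).2, ← Multiset.sum_map_mul_left, Multiset.map_map]
    refine congrArg _ (Multiset.map_congr rfl fun S _ => ?_)
    simp only [Function.comp_def, Rect.kronecker, Finset.mem_map_equiv, Equiv.symm_apply_apply,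
      Finset.mem_product]
    split_ifs <;> first | rfl | tauto

/-- `HasCover n a b w` says that `D_{2 ^ n}` has a `SUM`-covering of weight at most `w` when every
row of a rectangle is charged `a` and every column `b`. Up to repetition of lines, this is a
covering of complexity at most `w` of the product of an `a × b` rectangle with `D_{2 ^ n}`. -/
def HasCover (n : ℕ) (a b w : ℝ) : Prop :=
  ∃ F : Multiset (Rect (Finset (Fin n)) (Finset (Fin n))),
    IsSumCovering F (disjointnessMatrix n) ∧
      (F.map fun R => a * R.rows.card + b * R.cols.card).sum ≤ w

theorem HasCover.mono {n : ℕ} {a b w w' : ℝ} (h : HasCover n a b w) (hw : w ≤ w') :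
    HasCover n a b w' := by
  obtain ⟨F, hF, h⟩ := h
  exact ⟨F, hF, h.trans hw⟩

theorem HasCover.symm {n : ℕ} {a b w : ℝ} (h : HasCover n a b w) : HasCover n b a w := by
  obtain ⟨F, hF, h⟩ := h
  refine ⟨F.map Rect.transpose, hF.transpose_disjointnessMatrix, ?_⟩
  simpa only [Multiset.map_map, Function.comp_def, Rect.transpose, add_comm] using h

theorem HasCover.bind {t n : ℕ} {H : Multiset (Rect (Finset (Fin t)) (Finset (Fin t)))}
    (hH : IsSumCovering H (disjointnessMatrix t)) {a b : ℝ}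
    {w : Rect (Finset (Fin t)) (Finset (Fin t)) → ℝ}
    (h : ∀ R ∈ H, HasCover n (a * R.rows.card) (b * R.cols.card) (w R)) :
    HasCover (t + n) a b (H.map w).sum := by
  choose! G hG hw using h
  refine ⟨_, hH.bind_kronecker hG, ?_⟩
  rw [Multiset.map_bind, Multiset.sum_bind]
  refine Multiset.sum_map_le_sum_map _ _ fun R hR => le_trans (le_of_eq ?_) (hw R hR)
  rw [Multiset.map_map]
  refine congrArg _ (Multiset.map_congr rfl fun S _ => ?_)
  simp only [Function.comp_def, Rect.kronecker, Finset.card_map, Finset.card_product]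
  push_cast
  ring

theorem HasCover.sumComplexity_le {n : ℕ} {w : ℝ} (h : HasCover n 1 1 w) :
    (sumComplexity (disjointnessMatrix n) : ℝ) ≤ w := by
  obtain ⟨F, hF, h⟩ := h
  have h₁ : sumComplexity (disjointnessMatrix n) ≤ coveringComplexity F :=
    Nat.sInf_le ⟨F, hF, rfl⟩
  refine (Nat.cast_le.2 h₁).trans (le_trans (le_of_eq ?_) h)
  rw [coveringComplexity, ← Nat.coe_castAddMonoidHom, map_multiset_sum, Multiset.map_map]
  simp [Function.comp_def, Rect.complexity]

/-! ### Moments of coverings and the potential -/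

/-- The weighted geometric mean `a ^ s * b ^ (1 - s)`. -/
noncomputable def wmean (s a b : ℝ) : ℝ := a ^ s * b ^ (1 - s)

theorem wmean_one (a b : ℝ) : wmean 1 a b = a := by simp [wmean]

theorem wmean_zero (a b : ℝ) : wmean 0 a b = b := by simp [wmean]

theorem wmean_nonneg (s : ℝ) {a b : ℝ} (ha : 0 ≤ a) (hb : 0 ≤ b) : 0 ≤ wmean s a b := by
  unfold wmean; positivity

theorem wmean_swap (s a b : ℝ) : wmean s b a = wmean (1 - s) a b := by
  simp [wmean, mul_comm]

theorem wmean_mul (s : ℝ) {a b c d : ℝ} (ha : 0 ≤ a) (hb : 0 ≤ b) (hc : 0 ≤ c) (hd : 0 ≤ d) :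
    wmean s (a * c) (b * d) = wmean s a b * wmean s c d := by
  simp only [wmean, Real.mul_rpow ha hc, Real.mul_rpow hb hd]
  ring

theorem wmean_mono {s s' a b : ℝ} (hb : 0 < b) (hab : b ≤ a) (hs : s ≤ s') :
    wmean s a b ≤ wmean s' a b := by
  have h : ∀ s, wmean s a b = b * (a / b) ^ s := fun s => by
    rw [wmean, Real.rpow_sub hb, Real.rpow_one, Real.div_rpow (hb.le.trans hab) hb.le]
    ring
  rw [h, h]
  exact mul_le_mul_of_nonneg_left
    (Real.rpow_le_rpow_of_exponent_le ((one_le_div hb).2 hab) hs) hb.le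

/-- The `s`-th moment of a family of rectangles, the sum of `r ^ s * c ^ (1 - s)` over its `r × c`
rectangles. The exponent `1 / 2` gives the spectral weight, the exponents `1` and `0` count the
rows and the columns. -/
noncomputable def moment {m n : Type*} (s : ℝ) (F : Multiset (Rect m n)) : ℝ :=
  (F.map fun R => wmean s R.rows.card R.cols.card).sum

theorem moment_nonneg {m n : Type*} (s : ℝ) (F : Multiset (Rect m n)) : 0 ≤ moment s F := by
  refine Multiset.sum_nonneg fun x hx => ?_
  obtain ⟨R, -, rfl⟩ := Multiset.mem_map.1 hx
  exact wmean_nonneg _ (Nat.cast_nonneg _) (Nat.cast_nonneg _)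

theorem moment_transpose {m n : Type*} [DecidableEq m] [DecidableEq n] (s : ℝ)
    (F : Multiset (Rect m n)) : moment s (F.map Rect.transpose) = moment (1 - s) F := by
  rw [moment, Multiset.map_map]
  exact congrArg _ (Multiset.map_congr rfl fun R _ => wmean_swap _ _ _)

theorem moment_half {m n : Type*} (F : Multiset (Rect m n)) :
    moment (1 / 2) F = coveringSpectralWeight F := by
  refine congrArg _ (Multiset.map_congr rfl fun R _ => ?_)
  rw [Rect.spectralWeight, Real.sqrt_eq_rpow, Real.mul_rpow (Nat.cast_nonneg _) (Nat.cast_nonneg _),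
    wmean]
  norm_num

theorem sum_map_wmean_mul {m n : Type*} (s : ℝ) (F : Multiset (Rect m n)) {a b : ℝ}
    (ha : 0 ≤ a) (hb : 0 ≤ b) :
    (F.map fun R => wmean s (a * R.rows.card) (b * R.cols.card)).sum =
      wmean s a b * moment s F := by
  simp only [wmean_mul s ha hb (Nat.cast_nonneg _) (Nat.cast_nonneg _), moment,
    Multiset.sum_map_mul_left]

theorem moment_rowCovering (s : ℝ) (t : ℕ) : moment s (rowCovering t) = (1 + 2 ^ (1 - s)) ^ t := by
  have h : ∀ u : Finset (Fin t),
      wmean s ((fullRowRect t u).rows.card : ℕ) ((fullRowRect t u).cols.card : ℕ) =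
        1 ^ u.card * ((2 : ℝ) ^ (1 - s)) ^ (t - u.card) := fun u => by
    simp only [wmean, fullRowRect, Finset.card_singleton, Finset.card_powerset, Finset.card_compl,
      Fintype.card_fin]
    push_cast
    rw [Real.one_rpow, one_pow, ← Real.rpow_natCast, ← Real.rpow_natCast,
      ← Real.rpow_mul two_pos.le, ← Real.rpow_mul two_pos.le, mul_comm (1 - s)]
  simp only [moment, rowCovering, Multiset.map_map, Function.comp_def, h, Finset.sum_map_val]
  exact Fin.sum_pow_mul_eq_add_pow 1 _

/-- The potential that bounds, up to a constant factor, the cost of covering `D_{2 ^ (15 * m)}`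
when rows are charged `a` and columns `b`; here `σ` is the spectral weight of the gradient
covering of `D_{2 ^ 15}`. The first term is the intended bound. Its factor `2 - (1999 / 2000) ^ m`
is bounded but increases with `m`, and the increments absorb the error terms. The second term
decays relative to the first, and measures moderate imbalance. The third one pays for very
unbalanced rectangles; its base `65536 = 2 * 2 ^ 15` exceeds `2 ^ 15`, the factor for the number
of rows when `D_{2 ^ 15}` is covered by its rows. -/
noncomputable def potential (σ κ : ℝ) (m : ℕ) (a b : ℝ) : ℝ :=
  κ * (2 - (1999 / 2000) ^ m) * σ ^ m * wmean (1 / 2) a b +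
    (1999 / 2000 * σ) ^ m * (wmean (27 / 50) a b + wmean (23 / 50) a b) +
    65536 ^ m * (a + b)

theorem potential_symm (σ κ : ℝ) (m : ℕ) (a b : ℝ) :
    potential σ κ m a b = potential σ κ m b a := by
  have h : wmean (1 / 2) b a = wmean (1 / 2) a b := by rw [wmean_swap]; norm_num
  have h₁ : wmean (27 / 50) b a = wmean (23 / 50) a b := by rw [wmean_swap]; norm_num
  have h₂ : wmean (23 / 50) b a = wmean (27 / 50) a b := by rw [wmean_swap]; norm_num
  simp only [potential, h, h₁, h₂]
  ring

theorem sum_map_potential {m n : Type*} (σ κ : ℝ) (k : ℕ) (F : Multiset (Rect m n)) {a b : ℝ}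
    (ha : 0 ≤ a) (hb : 0 ≤ b) :
    (F.map fun R => potential σ κ k (a * R.rows.card) (b * R.cols.card)).sum =
      κ * (2 - (1999 / 2000) ^ k) * σ ^ k * (wmean (1 / 2) a b * moment (1 / 2) F) +
      (1999 / 2000 * σ) ^ k * (wmean (27 / 50) a b * moment (27 / 50) F +
        wmean (23 / 50) a b * moment (23 / 50) F) +
      65536 ^ k * (a * moment 1 F + b * moment 0 F) := by
  have h₁ := sum_map_wmean_mul 1 F ha hb
  have h₀ := sum_map_wmean_mul 0 F ha hb
  simp only [wmean_one, wmean_zero] at h₁ h₀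
  simp only [potential, Multiset.sum_map_add, Multiset.sum_map_mul_left,
    sum_map_wmean_mul _ F ha hb, h₁, h₀]

/-- The bound uses `49 ^ (23 / 50) ≤ 31 / 5`. -/
theorem le_pow_mul_wmean {a b : ℝ} (hb : 0 < b) (hba : b ≤ a) {k : ℕ} (h : a ≤ 49 ^ k * b) :
    a ≤ (31 / 5) ^ k * wmean (27 / 50) a b := by
  have ha : 0 < a := hb.trans_le hba
  have hμ : (49 : ℝ) ^ (23 / 50 : ℝ) ≤ 31 / 5 := by
    rw [← pow_le_pow_iff_left₀ (by positivity) (by norm_num) (n := 50) (by norm_num),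
      ← Real.rpow_natCast, ← Real.rpow_mul (by norm_num)]
    norm_num
  calc a = a ^ (27 / 50 : ℝ) * a ^ (23 / 50 : ℝ) := by
        rw [← Real.rpow_add ha]; norm_num
    _ ≤ a ^ (27 / 50 : ℝ) * (49 ^ k * b) ^ (23 / 50 : ℝ) := by gcongr
    _ = ((49 : ℝ) ^ (23 / 50 : ℝ)) ^ k * wmean (27 / 50) a b := by
        rw [Real.mul_rpow (by positivity) hb.le, ← Real.rpow_natCast, ← Real.rpow_mul (by norm_num),
          mul_comm (k : ℝ), Real.rpow_mul (by norm_num), Real.rpow_natCast, wmean]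
        norm_num
        ring
    _ ≤ _ := by
        have := wmean_nonneg (27 / 50) ha.le hb.le
        gcongr

theorem pow_mul_wmean_le {a b : ℝ} (hb : 0 < b) (hba : b ≤ a) {k : ℕ} (h : 49 ^ k * b ≤ a) :
    7 ^ k * wmean (1 / 2) a b ≤ a := by
  have ha : 0 < a := hb.trans_le hba
  have h7 : (7 : ℝ) ^ k = ((49 : ℝ) ^ k) ^ (1 / 2 : ℝ) := by
    rw [← Real.sqrt_eq_rpow, show (49 : ℝ) = 7 ^ 2 by norm_num, ← pow_mul, mul_comm 2, pow_mul,
      Real.sqrt_sq (by positivity)]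
  calc 7 ^ k * wmean (1 / 2) a b = a ^ (1 / 2 : ℝ) * (49 ^ k * b) ^ (1 / 2 : ℝ) := by
        rw [Real.mul_rpow (by positivity) hb.le, h7, wmean]
        norm_num
        ring
    _ ≤ a ^ (1 / 2 : ℝ) * a ^ (1 / 2 : ℝ) := by gcongr
    _ = a := by rw [← Real.rpow_add ha]; norm_num

/-- The step for moderately unbalanced rectangles: the covering has the spectral weight `σ`
itself, and the moment `27 / 50` is smaller than `σ`. -/
theorem sum_map_potential_le_of_balanced {m n : Type*} {σ κ : ℝ} {k : ℕ}
    {F : Multiset (Rect m n)} {a b : ℝ} (hσ : 442400 ≤ σ) (hκ : 0 ≤ κ) (hb : 0 < b) (hba : b ≤ a)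
    (hab : a ≤ 49 ^ k * b) (hk : 2 * κ * (65536 * (31 / 5)) ^ k ≤ (1999 / 2000 * σ) ^ k)
    (hhalf : moment (1 / 2) F = σ) (hα : moment (27 / 50) F ≤ 442100)
    (hα' : moment (23 / 50) F ≤ κ) (h₁ : moment 1 F ≤ κ) (h₀ : moment 0 F ≤ κ) :
    (F.map fun R => potential σ κ k (a * R.rows.card) (b * R.cols.card)).sum ≤
      potential σ κ (k + 1) a b := by
  have ha : 0 < a := hb.trans_le hba
  rw [sum_map_potential _ _ _ _ ha.le hb.le, potential, hhalf]
  have hx := wmean_nonneg (1 / 2) ha.le hb.le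
  have hy := wmean_nonneg (27 / 50) ha.le hb.le
  have hz := wmean_nonneg (23 / 50) ha.le hb.le
  have hzx : wmean (23 / 50) a b ≤ wmean (1 / 2) a b := wmean_mono hb hba (by norm_num)
  have hay := le_pow_mul_wmean hb hba hab
  set x := wmean (1 / 2) a b
  set y := wmean (27 / 50) a b
  set z := wmean (23 / 50) a b
  have hσ0 : 0 ≤ σ := by linarith
  have hP : (0 : ℝ) ≤ (1999 / 2000 * σ) ^ k := by positivity
  have e₁ : (1999 / 2000 * σ) ^ k * (y * moment (27 / 50) F) ≤
      (1999 / 2000 * σ) ^ (k + 1) * y - (1999 / 2000 * σ) ^ k * y := by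
    have : y * moment (27 / 50) F ≤ (1999 / 2000 * σ - 1) * y := by nlinarith
    calc _ ≤ (1999 / 2000 * σ) ^ k * ((1999 / 2000 * σ - 1) * y) := by gcongr
      _ = _ := by ring
  have e₂ : (1999 / 2000 * σ) ^ k * (z * moment (23 / 50) F) ≤
      κ * ((1999 / 2000) ^ k - (1999 / 2000) ^ (k + 1)) * σ ^ (k + 1) * x := by
    have := moment_nonneg (23 / 50) F
    calc _ ≤ (1999 / 2000 * σ) ^ k * (x * κ) := by gcongr
      _ ≤ (1999 / 2000 * σ) ^ k * (x * κ) * (σ / 2000) :=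
          le_mul_of_one_le_right (by positivity) (by linarith)
      _ = _ := by rw [mul_pow]; ring
  have e₃ : 65536 ^ k * (a * moment 1 F + b * moment 0 F) ≤ (1999 / 2000 * σ) ^ k * y := by
    calc 65536 ^ k * (a * moment 1 F + b * moment 0 F) ≤ 65536 ^ k * (a * κ + a * κ) := by
          have := moment_nonneg 0 F
          gcongr
      _ ≤ 65536 ^ k * ((31 / 5) ^ k * y * κ + (31 / 5) ^ k * y * κ) := by gcongr
      _ = 2 * κ * (65536 * (31 / 5)) ^ k * y := by rw [mul_pow]; ring
      _ ≤ _ := by gcongr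
  have e₄ : 0 ≤ (1999 / 2000 * σ) ^ (k + 1) * z := by positivity
  have e₅ : (0 : ℝ) ≤ 65536 ^ (k + 1) * (a + b) := by positivity
  linear_combination e₁ + e₂ + e₃ + e₄ + e₅

/-- The step for very unbalanced rectangles: the covering may have a larger spectral weight, but
its number of rows is at most `2 ^ 15`, so the term linear in `a` is contracted. -/
theorem sum_map_potential_le_of_unbalanced {m n : Type*} {σ κ : ℝ} {k : ℕ}
    {F : Multiset (Rect m n)} {a b : ℝ} (hσ : 442400 ≤ σ) (hκ : 0 ≤ κ) (hb : 0 < b) (hba : b ≤ a)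
    (hab : 49 ^ k * b ≤ a) (hk : 2 * κ ^ 2 * σ ^ k ≤ (65536 * 7) ^ k)
    (hhalf : moment (1 / 2) F ≤ κ) (hα : moment (27 / 50) F ≤ 442100)
    (hα' : moment (23 / 50) F ≤ κ) (h₁ : moment 1 F ≤ 32768) (h₀ : moment 0 F ≤ κ) :
    (F.map fun R => potential σ κ k (a * R.rows.card) (b * R.cols.card)).sum ≤
      potential σ κ (k + 1) a b := by
  have ha : 0 < a := hb.trans_le hba
  rw [sum_map_potential _ _ _ _ ha.le hb.le, potential]
  have hx := wmean_nonneg (1 / 2) ha.le hb.le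
  have hy := wmean_nonneg (27 / 50) ha.le hb.le
  have hz := wmean_nonneg (23 / 50) ha.le hb.le
  have hzx : wmean (23 / 50) a b ≤ wmean (1 / 2) a b := wmean_mono hb hba (by norm_num)
  have hbx : b ≤ wmean (1 / 2) a b := by
    simpa only [wmean_zero] using wmean_mono (s := 0) (s' := 1 / 2) hb hba (by norm_num)
  have hxa := pow_mul_wmean_le hb hba hab
  set x := wmean (1 / 2) a b
  set y := wmean (27 / 50) a b
  set z := wmean (23 / 50) a b
  have hσ0 : 0 ≤ σ := by linarith
  have hP : (0 : ℝ) ≤ (1999 / 2000 * σ) ^ k := by positivity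
  have hM := moment_nonneg (1 / 2) F
  have hg : ((1999 / 2000 : ℝ)) ^ k ≤ 1 := pow_le_one₀ (by norm_num) (by norm_num)
  have hg0 : (0 : ℝ) ≤ (1999 / 2000) ^ k := by positivity
  have hg' : ((1999 / 2000 : ℝ)) ^ (k + 1) ≤ 1 := pow_le_one₀ (by norm_num) (by norm_num)
  have e₁ : (1999 / 2000 * σ) ^ k * (y * moment (27 / 50) F) ≤ (1999 / 2000 * σ) ^ (k + 1) * y := by
    have : y * moment (27 / 50) F ≤ 1999 / 2000 * σ * y := by nlinarith
    calc _ ≤ (1999 / 2000 * σ) ^ k * (1999 / 2000 * σ * y) := by gcongr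
      _ = _ := by ring
  have e₂ : (1999 / 2000 * σ) ^ k * (z * moment (23 / 50) F) + 65536 ^ k * (b * moment 0 F) ≤
      κ * (2 - (1999 / 2000) ^ (k + 1)) * σ ^ (k + 1) * x := by
    have := moment_nonneg (23 / 50) F
    have := moment_nonneg 0 F
    calc _ ≤ (1999 / 2000 * σ) ^ k * (x * κ) + (1999 / 2000 * σ) ^ k * (x * κ) := by
          gcongr
          linarith
      _ = (1999 / 2000 * σ) ^ k * (x * κ) * 2 := by ring
      _ ≤ (1999 / 2000 * σ) ^ k * (x * κ) * (σ / 2000) := by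
          gcongr
          linarith
      _ = κ * ((1999 / 2000) ^ k - (1999 / 2000) ^ (k + 1)) * σ ^ (k + 1) * x := by
          rw [mul_pow]; ring
      _ ≤ _ := by
          gcongr
          linarith
  have e₃ : κ * (2 - (1999 / 2000) ^ k) * σ ^ k * (x * moment (1 / 2) F) ≤ 65536 ^ k * a := by
    calc _ ≤ κ * 2 * σ ^ k * (x * κ) := by
          gcongr
          linarith
      _ = 2 * κ ^ 2 * σ ^ k * x := by ring
      _ ≤ (65536 * 7) ^ k * x := by gcongr
      _ = 65536 ^ k * (7 ^ k * x) := by rw [mul_pow]; ring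
      _ ≤ _ := by gcongr
  have e₄ : 0 ≤ (1999 / 2000 * σ) ^ (k + 1) * z := by positivity
  have e₅ : 65536 ^ k * a + 65536 ^ k * (a * moment 1 F) ≤ 65536 ^ (k + 1) * (a + b) := by
    have : a + a * moment 1 F ≤ 65536 * (a + b) := by nlinarith
    calc _ = 65536 ^ k * (a + a * moment 1 F) := by ring
      _ ≤ 65536 ^ k * (65536 * (a + b)) := by gcongr
      _ = _ := by ring
  linear_combination e₁ + e₂ + e₃ + e₄ + e₅

/-! ### Line lengths of the gradient covering -/

/-- The number of subsets of a `t`-element set that avoid a given `k`-element set and whose size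
satisfies `p`. -/
def avoidCount (t k : ℕ) (p : ℕ → Prop) [DecidablePred p] : ℕ :=
  ∑ j ∈ Finset.range (t - k + 1), (t - k).choose j * if p j then 1 else 0

theorem card_filter_disjoint {t : ℕ} (v : Finset (Fin t)) (p : ℕ → Prop) [DecidablePred p] :
    (Finset.univ.filter fun u : Finset (Fin t) => p u.card ∧ Disjoint u v).card =
      avoidCount t v.card p := by
  have h : (Finset.univ.filter fun u : Finset (Fin t) => p u.card ∧ Disjoint u v) =
      vᶜ.powerset.filter fun u => p u.card := by
    ext u
    rw [Finset.mem_filter, Finset.mem_filter, Finset.mem_powerset, and_comm (a := u ⊆ vᶜ)]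
    simp only [Finset.mem_univ, true_and]
    exact and_congr_right fun _ => (le_compl_iff_disjoint_right (a := u) (b := v)).symm
  rw [h, Finset.card_filter, Finset.sum_powerset_apply_card (fun j => if p j then 1 else 0),
    Finset.card_compl, Fintype.card_fin]
  simp [avoidCount]

theorem sum_filter_card {t : ℕ} (p : ℕ → Prop) [DecidablePred p] (g : ℕ → ℝ) :
    ∑ v : Finset (Fin t) with p v.card, g v.card =
      ∑ k ∈ Finset.range (t + 1), t.choose k * if p k then g k else 0 := by
  have := Finset.sum_powerset_apply_card (fun j => if p j then g j else 0)
    (x := (Finset.univ : Finset (Fin t)))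
  rw [Finset.powerset_univ, Finset.card_univ, Fintype.card_fin] at this
  rw [Finset.sum_filter, this]
  simp [nsmul_eq_mul]

theorem moment_gradientCovering (s : ℝ) (t : ℕ) :
    moment s (gradientCovering t) =
      ∑ k ∈ Finset.range (t + 1), t.choose k *
        ((if 2 * k ≤ t then (avoidCount t k (k ≤ ·) : ℝ) ^ s else 0) +
          if 2 * k < t then (avoidCount t k (k < ·) : ℝ) ^ (1 - s) else 0) := by
  have h₁ : ∀ v : Finset (Fin t),
      wmean s ((columnRect t v).rows.card : ℕ) ((columnRect t v).cols.card : ℕ) =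
        (avoidCount t v.card (v.card ≤ ·) : ℝ) ^ s := fun v => by
    simp [wmean, columnRect, card_filter_disjoint v (v.card ≤ ·)]
  have h₂ : ∀ u : Finset (Fin t),
      wmean s ((rowRect t u).rows.card : ℕ) ((rowRect t u).cols.card : ℕ) =
        (avoidCount t u.card (u.card < ·) : ℝ) ^ (1 - s) := fun u => by
    simp [wmean, rowRect, disjoint_comm (a := u), card_filter_disjoint u (u.card < ·)]
  simp only [moment, gradientCovering, Multiset.map_add, Multiset.sum_add, Multiset.map_map,
    Function.comp_def, h₁, h₂, Finset.sum_map_val]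
  rw [sum_filter_card (2 * · ≤ t) fun k => (avoidCount t k (k ≤ ·) : ℝ) ^ s,
    sum_filter_card (2 * · < t) fun k => (avoidCount t k (k < ·) : ℝ) ^ (1 - s),
    ← Finset.sum_add_distrib]
  simp only [mul_add]

/-- The numbers `avoidCount 15 k` for `k = 0, …, 7` are the line lengths of the covering. -/
theorem moment_gradientCovering_fifteen (s : ℝ) :
    moment s (gradientCovering 15) =
      (32768 ^ s + 32767 ^ (1 - s)) + 15 * (16383 ^ s + 16369 ^ (1 - s)) +
      105 * (8178 ^ s + 8100 ^ (1 - s)) + 455 * (4017 ^ s + 3797 ^ (1 - s)) +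
      1365 * (1816 ^ s + 1486 ^ (1 - s)) + 3003 * (638 ^ s + 386 ^ (1 - s)) +
      5005 * (130 ^ s + 46 ^ (1 - s)) + 6435 * (9 ^ s + 1) := by
  rw [moment_gradientCovering]
  norm_num [Finset.sum_range_succ, avoidCount, Nat.choose]

/-! ### Numerical bounds and the recursion -/

theorem rpow_div_le {x q : ℝ} {i j : ℕ} (hj : j ≠ 0) (hx : 0 ≤ x) (hq : 0 ≤ q)
    (h : x ^ i ≤ q ^ j) : x ^ (i / j : ℝ) ≤ q := by
  rw [← pow_le_pow_iff_left₀ (by positivity) hq hj, ← Real.rpow_natCast, ← Real.rpow_mul hx,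
    div_mul_cancel₀ _ (by exact_mod_cast hj), Real.rpow_natCast]
  exact h

/-- After transposition this is the moment `27 / 50`. It falls below the spectral weight because the
rectangles of the gradient covering have more rows than columns on average. -/
theorem moment_gradientCovering_fifteen_le : moment (23 / 50) (gradientCovering 15) ≤ 442100 := by
  have h₁ : ∀ x q : ℝ, 0 ≤ x → 0 ≤ q → x ^ 23 ≤ q ^ 50 → x ^ (23 / 50 : ℝ) ≤ q :=
    fun x q hx hq h => by exact_mod_cast rpow_div_le (i := 23) (j := 50) (by norm_num) hx hq h
  have h₂ : ∀ x q : ℝ, 0 ≤ x → 0 ≤ q → x ^ 27 ≤ q ^ 50 → x ^ (1 - 23 / 50 : ℝ) ≤ q :=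
    fun x q hx hq h => by
      rw [show (1 - 23 / 50 : ℝ) = 27 / 50 by norm_num]
      exact_mod_cast rpow_div_le (i := 27) (j := 50) (by norm_num) hx hq h
  rw [moment_gradientCovering_fifteen]
  linarith only [
    h₁ 32768 (119429 / 1000) (by norm_num) (by norm_num) (by norm_num),
    h₂ 32767 (274370 / 1000) (by norm_num) (by norm_num) (by norm_num),
    h₁ 16383 (86821 / 1000) (by norm_num) (by norm_num) (by norm_num),
    h₂ 16369 (188614 / 1000) (by norm_num) (by norm_num) (by norm_num),
    h₁ 8178 (63070 / 1000) (by norm_num) (by norm_num) (by norm_num),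
    h₂ 8100 (128998 / 1000) (by norm_num) (by norm_num) (by norm_num),
    h₁ 4017 (45478 / 1000) (by norm_num) (by norm_num) (by norm_num),
    h₂ 3797 (85684 / 1000) (by norm_num) (by norm_num) (by norm_num),
    h₁ 1816 (31565 / 1000) (by norm_num) (by norm_num) (by norm_num),
    h₂ 1486 (51629 / 1000) (by norm_num) (by norm_num) (by norm_num),
    h₁ 638 (19509 / 1000) (by norm_num) (by norm_num) (by norm_num),
    h₂ 386 (24933 / 1000) (by norm_num) (by norm_num) (by norm_num),
    h₁ 130 (9385 / 1000) (by norm_num) (by norm_num) (by norm_num),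
    h₂ 46 (7905 / 1000) (by norm_num) (by norm_num) (by norm_num),
    h₁ 9 (2748 / 1000) (by norm_num) (by norm_num) (by norm_num)]

/-- The spectral weight of the gradient covering of `D_{2 ^ 15}` is `442411.8…`. -/
theorem coveringSpectralWeight_gradientCovering_fifteen :
    coveringSpectralWeight (gradientCovering 15) ∈ Set.Icc (442400 : ℝ) 445000 := by
  have h : ∀ x p q : ℝ, 0 ≤ p → 0 ≤ q → p ^ 2 ≤ x → x ≤ q ^ 2 → x ^ (1 / 2 : ℝ) ∈ Set.Icc p q :=
    fun x p q hp hq h₁ h₂ => by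
      rw [← Real.sqrt_eq_rpow]
      exact ⟨Real.le_sqrt_of_sq_le h₁, Real.sqrt_le_iff.2 ⟨hq, h₂⟩⟩
  rw [← moment_half, moment_gradientCovering_fifteen, show (1 - 1 / 2 : ℝ) = 1 / 2 by norm_num]
  have h0 := h 32768 (1810193 / 10000) (18102 / 100) (by norm_num) (by norm_num) (by norm_num)
    (by norm_num)
  have h1 := h 32767 (1810165 / 10000) (18102 / 100) (by norm_num) (by norm_num) (by norm_num)
    (by norm_num)
  have h2 := h 16383 (1279960 / 10000) (12800 / 100) (by norm_num) (by norm_num) (by norm_num)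
    (by norm_num)
  have h3 := h 16369 (1279413 / 10000) (12795 / 100) (by norm_num) (by norm_num) (by norm_num)
    (by norm_num)
  have h4 := h 8178 (904322 / 10000) (9044 / 100) (by norm_num) (by norm_num) (by norm_num)
    (by norm_num)
  have h5 := h 8100 (900000 / 10000) (9000 / 100) (by norm_num) (by norm_num) (by norm_num)
    (by norm_num)
  have h6 := h 4017 (633798 / 10000) (6338 / 100) (by norm_num) (by norm_num) (by norm_num)
    (by norm_num)
  have h7 := h 3797 (616198 / 10000) (6162 / 100) (by norm_num) (by norm_num) (by norm_num)
    (by norm_num)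
  have h8 := h 1816 (426145 / 10000) (4262 / 100) (by norm_num) (by norm_num) (by norm_num)
    (by norm_num)
  have h9 := h 1486 (385486 / 10000) (3855 / 100) (by norm_num) (by norm_num) (by norm_num)
    (by norm_num)
  have h10 := h 638 (252586 / 10000) (2526 / 100) (by norm_num) (by norm_num) (by norm_num)
    (by norm_num)
  have h11 := h 386 (196468 / 10000) (1965 / 100) (by norm_num) (by norm_num) (by norm_num)
    (by norm_num)
  have h12 := h 130 (114017 / 10000) (1141 / 100) (by norm_num) (by norm_num) (by norm_num)
    (by norm_num)
  have h13 := h 46 (67823 / 10000) (679 / 100) (by norm_num) (by norm_num) (by norm_num)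
    (by norm_num)
  have h14 := h 9 (30000 / 10000) (300 / 100) (by norm_num) (by norm_num) (by norm_num)
    (by norm_num)
  constructor
  · linarith only [h0.1, h1.1, h2.1, h3.1, h4.1, h5.1, h6.1, h7.1,
      h8.1, h9.1, h10.1, h11.1, h12.1, h13.1, h14.1]
  · linarith only [h0.2, h1.2, h2.2, h3.2, h4.2, h5.2, h6.2, h7.2,
      h8.2, h9.2, h10.2, h11.2, h12.2, h13.2, h14.2]

/-- The exponent `27 / 50` is large enough for the covering by rows to have a moment below the
spectral weight of the gradient covering as well; at `1 / 2` its moment would be larger. -/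
theorem moment_rowCovering_fifteen_le : moment (27 / 50) (rowCovering 15) ≤ 442100 := by
  have h : (2 : ℝ) ^ (1 - 27 / 50 : ℝ) ≤ 1376 / 1000 := by
    rw [show (1 - 27 / 50 : ℝ) = 23 / 50 by norm_num]
    exact_mod_cast rpow_div_le (i := 23) (j := 50) (x := 2) (by norm_num) (by norm_num)
      (by norm_num) (by norm_num)
  rw [moment_rowCovering]
  calc _ ≤ (1 + 1376 / 1000 : ℝ) ^ 15 := by gcongr
    _ ≤ _ := by norm_num

/-- One step of the recursion: when the number `k` of factors that remain after it is large enough,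
some covering of `D_{2 ^ 15}` has total potential at most that of the given shape `a × b`. -/
theorem exists_covering_sum_map_potential_le :
    ∃ κ : ℝ, 0 ≤ κ ∧ ∃ k₀ : ℕ, ∀ k ≥ k₀, ∀ a b : ℝ, 0 < b → b ≤ a →
      ∃ F : Multiset (Rect (Finset (Fin 15)) (Finset (Fin 15))),
        IsSumCovering F (disjointnessMatrix 15) ∧
        (F.map fun R => potential (coveringSpectralWeight (gradientCovering 15)) κ k
          (a * R.rows.card) (b * R.cols.card)).sum ≤
        potential (coveringSpectralWeight (gradientCovering 15)) κ (k + 1) a b := by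
  obtain ⟨hσ, hσ'⟩ := coveringSpectralWeight_gradientCovering_fifteen
  have hhalf := moment_half (gradientCovering 15)
  set σ := coveringSpectralWeight (gradientCovering 15)
  have hσ0 : 0 < σ := by linarith
  -- Apart from the moments that matter, all moments in use are bounded by a common constant.
  obtain ⟨κ, hκ⟩ : ∃ κ : ℝ, ∀ s ∈ ({1 / 2, 23 / 50, 27 / 50, 1, 0} : Finset ℝ),
      moment s (gradientCovering 15) ≤ κ ∧ moment s (rowCovering 15) ≤ κ := by
    refine ⟨∑ s ∈ ({1 / 2, 23 / 50, 27 / 50, 1, 0} : Finset ℝ),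
      (moment s (gradientCovering 15) + moment s (rowCovering 15)), fun s hs => ?_⟩
    have := Finset.single_le_sum (f := fun s => moment s (gradientCovering 15) +
      moment s (rowCovering 15)) (fun s _ => add_nonneg (moment_nonneg _ _) (moment_nonneg _ _)) hs
    have := moment_nonneg s (gradientCovering 15)
    have := moment_nonneg s (rowCovering 15)
    constructor <;> linarith
  have hκ0 : 0 ≤ κ := (moment_nonneg _ _).trans (hκ 0 (by simp)).1
  have key : ∀ c x y : ℝ, 0 ≤ c → 0 ≤ x → x < y → ∀ᶠ k : ℕ in atTop, c * x ^ k ≤ y ^ k := by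
    intro c x y hc hx hxy
    have hy : 0 < y := hx.trans_lt hxy
    have := (tendsto_pow_atTop_nhds_zero_of_lt_one (div_nonneg hx hy.le)
      ((div_lt_one hy).2 hxy)).const_mul c
    rw [mul_zero] at this
    filter_upwards [this.eventually (ge_mem_nhds one_pos)] with k hk
    rwa [div_pow, ← mul_div_assoc, div_le_one (by positivity)] at hk
  obtain ⟨k₀, hk₀⟩ := eventually_atTop.1
    ((key (2 * κ) (65536 * (31 / 5)) (1999 / 2000 * σ) (by positivity) (by positivity)
      (by linarith)).and
    (key (2 * κ ^ 2) σ (65536 * 7) (by positivity) hσ0.le (by linarith)))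
  refine ⟨κ, hκ0, k₀, fun k hk a b hb hba => ?_⟩
  -- The base `49` of the threshold has to satisfy `σ < 65536 * 49 ^ (1 / 2)` and
  -- `65536 * 49 ^ (23 / 50) < 1999 / 2000 * σ`.
  rcases le_total a (49 ^ k * b) with h | h
  · refine ⟨_, (isSumCovering_gradientCovering 15).transpose_disjointnessMatrix,
      sum_map_potential_le_of_balanced hσ hκ0 hb hba h (hk₀ k hk).1 ?_ ?_ ?_ ?_ ?_⟩ <;>
      rw [moment_transpose]
    · rw [← hhalf]; norm_num
    · convert moment_gradientCovering_fifteen_le using 2; norm_num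
    · convert (hκ (27 / 50) (by simp)).1 using 2; norm_num
    · convert (hκ 0 (by simp)).1 using 2; norm_num
    · convert (hκ 1 (by simp)).1 using 2; norm_num
  · refine ⟨_, isSumCovering_rowCovering 15,
      sum_map_potential_le_of_unbalanced hσ hκ0 hb hba h (hk₀ k hk).2 (hκ _ (by simp)).2
      moment_rowCovering_fifteen_le (hκ _ (by simp)).2 ?_ (hκ _ (by simp)).2⟩
    rw [moment_rowCovering]
    norm_num

theorem hasCover_rowCovering (n : ℕ) (a b : ℝ) : HasCover n a b (2 ^ n * a + 3 ^ n * b) := by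
  refine ⟨_, isSumCovering_rowCovering n, le_of_eq ?_⟩
  have h₁ := moment_rowCovering 1 n
  have h₀ := moment_rowCovering 0 n
  simp only [moment, wmean_one, wmean_zero] at h₁ h₀
  rw [Multiset.sum_map_add, Multiset.sum_map_mul_left, Multiset.sum_map_mul_left, h₁, h₀]
  norm_num
  ring

/-- The complexity of `D_{2 ^ n}` is at most of order `σ ^ ⌊n / 15⌋`, with `σ` the spectral weight
of the gradient covering of `D_{2 ^ 15}`. -/
theorem exists_sumComplexity_le : ∃ C : ℝ, 0 < C ∧ ∀ m s : ℕ, s < 15 →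
    (sumComplexity (disjointnessMatrix (15 * m + s)) : ℝ) ≤
      C * coveringSpectralWeight (gradientCovering 15) ^ m := by
  obtain ⟨hσ, -⟩ := coveringSpectralWeight_gradientCovering_fifteen
  obtain ⟨κ, hκ, k₀, hstep⟩ := exists_covering_sum_map_potential_le
  set σ := coveringSpectralWeight (gradientCovering 15)
  have hσ0 : 0 < σ := by linarith
  have hcover : ∀ s < 15, ∀ m : ℕ, ∀ a b : ℝ, 0 < a → 0 < b →
      HasCover (15 * m + s) a b (3 ^ 15 * potential σ κ (k₀ + m) a b) := by
    intro s hs m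
    induction m with
    | zero =>
      intro a b ha hb
      rw [mul_zero, zero_add, add_zero]
      refine (hasCover_rowCovering s a b).mono ?_
      have h₂ : (2 : ℝ) ^ s ≤ 3 ^ 15 :=
        (pow_le_pow_left₀ (by norm_num) (by norm_num) s).trans
          (pow_le_pow_right₀ (by norm_num) hs.le)
      have h₃ : (3 : ℝ) ^ s ≤ 3 ^ 15 := pow_le_pow_right₀ (by norm_num) hs.le
      have hpot : a + b ≤ potential σ κ k₀ a b := by
        have hg : ((1999 / 2000 : ℝ)) ^ k₀ ≤ 1 := pow_le_one₀ (by norm_num) (by norm_num)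
        have hx := wmean_nonneg (1 / 2) ha.le hb.le
        have hy := wmean_nonneg (27 / 50) ha.le hb.le
        have hz := wmean_nonneg (23 / 50) ha.le hb.le
        have h₁ : 0 ≤ κ * (2 - (1999 / 2000) ^ k₀) * σ ^ k₀ * wmean (1 / 2) a b := by
          have : (0 : ℝ) ≤ 2 - (1999 / 2000) ^ k₀ := by linarith
          positivity
        have h₂ : 0 ≤ (1999 / 2000 * σ) ^ k₀ * (wmean (27 / 50) a b + wmean (23 / 50) a b) := by
          positivity
        have h₃ : a + b ≤ 65536 ^ k₀ * (a + b) :=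
          le_mul_of_one_le_left (by positivity) (one_le_pow₀ (by norm_num))
        unfold potential
        linarith
      calc 2 ^ s * a + 3 ^ s * b ≤ 3 ^ 15 * a + 3 ^ 15 * b := by gcongr
        _ = 3 ^ 15 * (a + b) := by ring
        _ ≤ _ := by gcongr
    | succ m ih =>
      have hle : ∀ a b : ℝ, 0 < b → b ≤ a →
          HasCover (15 * (m + 1) + s) a b (3 ^ 15 * potential σ κ (k₀ + (m + 1)) a b) := by
        intro a b hb hba
        obtain ⟨F, hF, hsum⟩ := hstep (k₀ + m) (Nat.le_add_right _ _) a b hb hba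
        have := HasCover.bind hF (a := a) (b := b) fun R hR => by
          obtain ⟨h₁, h₂⟩ := hF.1 R hR
          exact ih (a * R.rows.card) (b * R.cols.card)
            (mul_pos (hb.trans_le hba) (Nat.cast_pos.2 h₁.card_pos))
            (mul_pos hb (Nat.cast_pos.2 h₂.card_pos))
        rw [show 15 * (m + 1) + s = 15 + (15 * m + s) by ring]
        refine this.mono ?_
        rw [Multiset.sum_map_mul_left]
        exact mul_le_mul_of_nonneg_left hsum (by positivity)
      intro a b ha hb
      rcases le_total b a with h | h
      · exact hle a b hb h
      · rw [potential_symm]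
        exact (hle b a ha h).symm
  refine ⟨3 ^ 15 * ((2 * κ + 4) * σ ^ k₀), by positivity, fun m s hs => ?_⟩
  refine (hcover s hs m 1 1 one_pos one_pos).sumComplexity_le.trans ?_
  have hg : (0 : ℝ) ≤ (1999 / 2000) ^ (k₀ + m) := by positivity
  have h₁ : (1999 / 2000 * σ) ^ (k₀ + m) ≤ σ ^ (k₀ + m) :=
    pow_le_pow_left₀ (by positivity) (by linarith) _
  have h₂ : (65536 : ℝ) ^ (k₀ + m) ≤ σ ^ (k₀ + m) :=
    pow_le_pow_left₀ (by positivity) (by linarith) _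
  have h₃ : κ * (2 - (1999 / 2000) ^ (k₀ + m)) * σ ^ (k₀ + m) ≤ κ * 2 * σ ^ (k₀ + m) := by
    gcongr
    linarith
  have hpot : potential σ κ (k₀ + m) 1 1 ≤ (2 * κ + 4) * σ ^ (k₀ + m) := by
    simp only [potential, wmean, Real.one_rpow]
    linarith
  calc 3 ^ 15 * potential σ κ (k₀ + m) 1 1 ≤ 3 ^ 15 * ((2 * κ + 4) * σ ^ (k₀ + m)) := by gcongr
    _ = _ := by rw [pow_add]; ring

/-- In terms of `N = 2 ^ n`, the power `N ^ log_{2 ^ 15} x` is `x ^ (n / 15)`. -/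
theorem pow_rpow_logb {x : ℝ} (hx : 0 < x) (n : ℕ) :
    ((2 : ℝ) ^ n) ^ Real.logb (2 ^ 15) x = x ^ (n / 15 : ℝ) := by
  have h : (2 : ℝ) ^ n = ((2 : ℝ) ^ 15) ^ (n / 15 : ℝ) := by
    rw [← Real.rpow_natCast 2 15, ← Real.rpow_mul two_pos.le, ← Real.rpow_natCast 2 n]
    congr 1
    push_cast
    ring
  rw [h, ← Real.rpow_mul (by positivity), mul_comm, Real.rpow_mul (by positivity),
    Real.rpow_logb (by positivity) (by norm_num) hx]

end KneserSierpinski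

theorem mainTheorem2 :
    KneserSierpinski.IsSumCovering (KneserSierpinski.gradientCovering 15)
        (KneserSierpinski.disjointnessMatrix 15) ∧
      (∃ C : ℝ, 0 < C ∧ ∀ n : ℕ,
        (KneserSierpinski.sumComplexity (KneserSierpinski.disjointnessMatrix n) : ℝ) ≤
          C * ((2 : ℝ) ^ n) ^ Real.logb ((2 : ℝ) ^ 15)
            (KneserSierpinski.coveringSpectralWeight (KneserSierpinski.gradientCovering 15))) ∧
      (fun n : ℕ => ((2 : ℝ) ^ n) ^ Real.logb ((2 : ℝ) ^ 15)
          (KneserSierpinski.coveringSpectralWeight (KneserSierpinski.gradientCovering 15)))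
        =o[atTop] fun n : ℕ => ((2 : ℝ) ^ n) ^ (1.251 : ℝ) := by
  obtain ⟨hσ, hσ'⟩ := KneserSierpinski.coveringSpectralWeight_gradientCovering_fifteen
  obtain ⟨C, hC, hbound⟩ := KneserSierpinski.exists_sumComplexity_le
  refine ⟨KneserSierpinski.isSumCovering_gradientCovering 15, ⟨C, hC, fun n => ?_⟩, ?_⟩
  · rw [KneserSierpinski.pow_rpow_logb (by linarith)]
    have h := hbound (n / 15) (n % 15) (Nat.mod_lt _ (by norm_num))
    rw [Nat.div_add_mod] at h
    refine h.trans (mul_le_mul_of_nonneg_left ?_ hC.le)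
    rw [← Real.rpow_natCast]
    exact Real.rpow_le_rpow_of_exponent_le (by linarith) Nat.cast_div_le
  · have hlt : Real.logb ((2 : ℝ) ^ 15)
        (KneserSierpinski.coveringSpectralWeight (KneserSierpinski.gradientCovering 15)) <
        (1.251 : ℝ) := by
      rw [Real.logb_lt_iff_lt_rpow (by norm_num) (by linarith)]
      refine hσ'.trans_lt ?_
      -- Since `15 * 1.251 = 3753 / 200`, the claim is `445000 ^ 200 < 2 ^ 3753`, and
      -- `3753 = 139 * 27`.
      have h : (((2 : ℝ) ^ 15) ^ (1.251 : ℝ)) ^ 200 = (2 ^ 139) ^ 27 := by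
        rw [← Real.rpow_natCast 2 15, ← Real.rpow_mul two_pos.le,
          ← Real.rpow_mul_natCast two_pos.le, ← pow_mul, ← Real.rpow_natCast 2 (139 * 27)]
        norm_num
      refine lt_of_pow_lt_pow_left₀ 200 (by positivity) ?_
      rw [h]
      norm_num
    have hpow : ∀ e : ℝ, (fun n : ℕ => ((2 : ℝ) ^ n) ^ e) = fun n => ((2 : ℝ) ^ e) ^ n := by
      intro e
      ext n
      rw [← Real.rpow_natCast, ← Real.rpow_natCast, ← Real.rpow_mul two_pos.le,
        ← Real.rpow_mul two_pos.le, mul_comm]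
    rw [hpow, hpow]
    exact isLittleO_pow_pow_of_lt_left (by positivity)
      (Real.rpow_lt_rpow_of_exponent_lt one_lt_two hlt)
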